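/- Let $p$ be an odd prime, $\Lambda=\mathbb{Z}_p[\![T]\!]$, and $\omega_n=(1+T)^{p^n}-1$ for $n\ge 0$. Put $\omega_{0,-1}:=\omega_0=T$ and $\omega_{a+1,a}:=\omega_{a+1}/\omega_a$ for $a\ge 0$. A pseudo-isomorphism is a $\Lambda$-linear map with finite kernel and finite cokernel. For a finitely generated $\Lambda$-module $X$ let $$\mathfrak{G}(X)=\varprojlim_n\left(\frac{X}{\omega_nX}[p^\infty]\right),$$ the limit being taken along the natural projections; $\mathfrak{G}$ is a covariant functor. Let $X$ be a finitely generated $\Lambda$-module. Then $\mathfrak{G}(X)$ is a finitely generated torsion $\Lambda$-module. Moreover, let $$E=\Lambda^{r}\oplus\bigoplus_{i=1}^{d}\frac{\Lambda}{(g_i^{l_i})}\oplus\bigoplus_{m=1}^{f}\frac{\Lambda}{(\omega_{a_m+1,a_m}^{e_m})}\oplus\bigoplus_{n=1}^{t}\frac{\Lambda}{(\omega_{b_n+1,b_n})},$$ where $r,d,f,t\ge 0$, the $g_i$ are prime elements of $\Lambda$ coprime to $\omega_n$ for all $n\geq 0$ (no common non-unit divisor), $l_i\ge 1$, $e_m\ge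 2$ and $a_m,b_n\ge -1$, and let $\phi:X\to E$ be a pseudo-isomorphism (so that $E$ is an elementary module of $X$). Then there is a $\Lambda$-linear isomorphism $$\mathfrak{G}(E)\simeq\bigoplus_{i=1}^{d}\frac{\Lambda}{(g_i^{l_i})}\oplus\bigoplus_{m=1}^{f}\frac{\Lambda}{(\omega_{a_m+1,a_m}^{e_m-1})}$$ whose composite with $\mathfrak{G}(\phi):\mathfrak{G}(X)\to\mathfrak{G}(E)$ is a pseudo-isomorphism $$\mathfrak{G}(X)\longrightarrow\bigoplus_{i=1}^{d}\frac{\Lambda}{(g_i^{l_i})}\oplus\bigoplus_{m=1}^{f}\frac{\Lambda}{(\omega_{a_m+1,a_m}^{e_m-1})}.$$ -/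

import Mathlib

namespace Iwasawa

/-- The Iwasawa algebra `Λ = ℤ_p⟦T⟧`. -/
abbrev Lam (p : ℕ) [Fact p.Prime] : Type := PowerSeries ℤ_[p]

section Elements

variable (p : ℕ) [Fact p.Prime]

/-- `ω_n = (1 + T)^(p^n) - 1`. -/
noncomputable def omega (n : ℕ) : Lam p := (1 + PowerSeries.X) ^ p ^ n - 1

/-- `ω_{n+1,n} = ω_{n+1} / ω_n`, written out as `∑_{i < p} (1 + T)^(p^n i)`;
see `omega_mul_omegaQuot`. -/
noncomputable def omegaQuot (n : ℕ) : Lam p :=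
  ∑ i ∈ Finset.range p, ((1 + PowerSeries.X) ^ p ^ n) ^ i

theorem omega_mul_omegaQuot (n : ℕ) : omega p n * omegaQuot p n = omega p (n + 1) := by
  unfold omega omegaQuot
  rw [mul_geom_sum, ← pow_mul, ← pow_succ]

theorem omega_zero : omega p 0 = PowerSeries.X := by
  simp [omega]

theorem omega_ne_zero (n : ℕ) : omega p n ≠ 0 := by
  intro h
  have h1 : (((1 + Polynomial.X : Polynomial ℤ_[p]) ^ p ^ n : Polynomial ℤ_[p]) :
      PowerSeries ℤ_[p]) = ((1 : Polynomial ℤ_[p]) : PowerSeries ℤ_[p]) := by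
    have := sub_eq_zero.mp h
    simpa using this
  have h2 := congrArg Polynomial.natDegree (Polynomial.coe_injective _ h1)
  have h3 : (1 + Polynomial.X : Polynomial ℤ_[p]) = Polynomial.X + Polynomial.C 1 := by
    simp [add_comm]
  rw [h3, Polynomial.natDegree_pow, Polynomial.natDegree_X_add_C] at h2
  have := (Fact.out : p.Prime).pos
  simp at h2
  omega

theorem omega_dvd {m n : ℕ} (h : m ≤ n) : omega p m ∣ omega p n := by
  induction n, h using Nat.le_induction with
  | base => exact dvd_rfl
  | succ k _ ih => exact ih.trans ⟨_, (omega_mul_omegaQuot p k).symm⟩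

/-- `ω_{k,k-1} = ω_k / ω_{k-1}` for all `k ≥ 0`, with the convention `ω_{-1} = 1`:
thus `omegaStep p 0 = ω_0 = T` and `omegaStep p (a + 1) = ω_{a+1,a}`. -/
noncomputable def omegaStep : ℕ → Lam p
  | 0 => omega p 0
  | a + 1 => omegaQuot p a

end Elements

section Modules

variable (p : ℕ) [Fact p.Prime]

/-- A pseudo-isomorphism: a `Λ`-linear map with finite kernel and finite cokernel. -/
def IsPseudoIso {p : ℕ} [Fact p.Prime] {M N : Type*} [AddCommMonoid M] [Module (Lam p) M]
    [AddCommGroup N] [Module (Lam p) N] (f : M →ₗ[Lam p] N) : Prop :=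
  Finite (LinearMap.ker f) ∧ Finite (N ⧸ LinearMap.range f)

variable (M : Type*) [AddCommGroup M] [Module (Lam p) M]

/-- The submodule `ω_n M` of `M`. -/
noncomputable def omegaSub (n : ℕ) : Submodule (Lam p) M :=
  LinearMap.range (LinearMap.lsmul (Lam p) M (omega p n))

theorem omegaSub_anti {m n : ℕ} (h : m ≤ n) : omegaSub p M n ≤ omegaSub p M m := by
  rintro _ ⟨x, rfl⟩
  obtain ⟨c, hc⟩ := omega_dvd p h
  exact ⟨c • x, by simp [hc, mul_smul, smul_comm c]⟩

/-- The submodule `M[p^∞]` of elements killed by a power of `p`. -/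
noncomputable def pPrimary : Submodule (Lam p) M :=
  Submodule.torsion' (Lam p) M (Submonoid.powers (p : Lam p))

/-- `𝔊(M)`, the inverse limit of `(M / ω_n M)[p^∞]` along the natural projections, realized as the
`Λ`-module of compatible sequences. -/
noncomputable def frakG : Submodule (Lam p) ((n : ℕ) → M ⧸ omegaSub p M n) where
  carrier := {x | (∀ n, x n ∈ pPrimary p (M ⧸ omegaSub p M n)) ∧
    ∀ (m n : ℕ) (h : m ≤ n), Submodule.factor (omegaSub_anti p M h) (x n) = x m}
  zero_mem' := ⟨fun _ => Submodule.zero_mem _, fun _ _ _ => map_zero _⟩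
  add_mem' := fun hx hy => ⟨fun n => Submodule.add_mem _ (hx.1 n) (hy.1 n), fun m n h => by
    rw [Pi.add_apply, map_add, hx.2 m n h, hy.2 m n h, Pi.add_apply]⟩
  smul_mem' := fun c x hx => ⟨fun n => Submodule.smul_mem _ c (hx.1 n), fun m n h => by
    rw [Pi.smul_apply, map_smul, hx.2 m n h, Pi.smul_apply]⟩

variable {M} {N : Type*} [AddCommGroup N] [Module (Lam p) N]

theorem omegaSub_le_comap (f : M →ₗ[Lam p] N) (n : ℕ) :
    omegaSub p M n ≤ (omegaSub p N n).comap f := by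
  rintro _ ⟨x, rfl⟩
  exact ⟨f x, by simp⟩

/-- The map `M / ω_n M → N / ω_n N` induced by `f : M → N`. -/
noncomputable def quotMap (f : M →ₗ[Lam p] N) (n : ℕ) :
    (M ⧸ omegaSub p M n) →ₗ[Lam p] (N ⧸ omegaSub p N n) :=
  Submodule.mapQ _ _ f (omegaSub_le_comap p f n)

/-- The map `𝔊(f) : 𝔊(M) → 𝔊(N)` induced by `f : M → N`, namely
`(x_n)_n ↦ (f(x_n) mod ω_n N)_n`. -/
noncomputable def frakGMap (f : M →ₗ[Lam p] N) : frakG p M →ₗ[Lam p] frakG p N :=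
  LinearMap.restrict (LinearMap.pi fun n => quotMap p f n ∘ₗ LinearMap.proj n) (by
    rintro x ⟨h1, h2⟩
    refine ⟨fun n => ?_, fun m n h => ?_⟩
    · obtain ⟨a, ha⟩ := h1 n
      refine ⟨a, ?_⟩
      have := congrArg (quotMap p f n) ha
      rw [map_zero, Submonoid.smul_def, map_smul] at this
      exact this
    · have := h2 m n h
      simp only [LinearMap.pi_apply, LinearMap.comp_apply, LinearMap.proj_apply]
      rw [← this]
      obtain ⟨y, hy⟩ := Submodule.Quotient.mk_surjective _ (x n)
      rw [← hy]
      rfl)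

end Modules

/-- The finite direct sum `⨁_i Λ / (q_i)`. -/
abbrev CyclicSum {p : ℕ} [Fact p.Prime] {k : ℕ} (q : Fin k → Lam p) : Type :=
  (i : Fin k) → Lam p ⧸ Ideal.span {q i}

/-- `Λ^r ⊕ ⨁_i Λ/(g_i^{l_i}) ⊕ ⨁_m Λ/(ω_{a_m,a_m-1}^{e_m}) ⊕ ⨁_n Λ/(ω_{b_n,b_n-1})`. -/
abbrev Elementary (p : ℕ) [Fact p.Prime] (r : ℕ) {d f t : ℕ} (g : Fin d → Lam p) (l : Fin d → ℕ)
    (a e : Fin f → ℕ) (b : Fin t → ℕ) : Type :=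
  (Fin r → Lam p) × CyclicSum (fun i => g i ^ l i) ×
    CyclicSum (fun m => omegaStep p (a m) ^ e m) × CyclicSum (fun n => omegaStep p (b n))

end Iwasawa

/-!
For a finitely generated `Λ`-module `M` the inverse limit `𝔊(M)` can be found inside `M`: since
`M = lim M / ω_n M`, it is the submodule `frakGSub p M` of all `x` in `M` such that for every `n`
some `p^k x` lies in `ω_n M` (`frakGSubEquiv`). Separatedness is Krull's intersection theorem,
because `ω_n` lies in the `n`-th power of the maximal ideal; completeness comes from the
compactness of `Λ` (`exists_forall_eq_add_mul_succ`).

In this description everything is elementary.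

* `𝔊(M)` is finitely generated because `Λ` is Noetherian. It is torsion because
  `frakGSub p Λ = 0`, so every linear functional `M → Λ` vanishes on `frakGSub p M`.
* A pseudo-isomorphism `f : M → N` has kernel and cokernel killed by powers of `p`, hence
  `f x ∈ frakGSub p N` forces `x ∈ frakGSub p M` (`mem_frakGSub_of_map_mem`). The kernel and
  cokernel of the restriction of `f` therefore embed into those of `f`.
* The submodule is compatible with finite direct sums, which leaves cyclic modules. It is all of
  `Λ/(g^l)`, because some power of `p` lies in `(g^l, ω_n)` (`isCoprimeAway_omega_of_prime`). It
  is zero for `Λ` and `Λ/(ω_{b,b-1})`, because `Λ/(ω_n)` has no `p`-torsion by Weierstrass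
  division. In `Λ/(w^e)` with `w = ω_{a,a-1}` it is the submodule generated by `w`, which is
  isomorphic to `Λ/(w^(e-1))`, because `w` and `ω_n/w` generate an ideal containing a power of `p`
  (`exists_omega_eq_omegaStep_mul`).
-/

namespace Iwasawa

/-! ### Coprimality after inverting an element -/

section CoprimeAway

variable {R : Type*} [CommRing R]

/-- The elements `f` and `h` generate an ideal that contains a power of `π`; equivalently, they
generate the unit ideal of `R[1/π]`. -/
def IsCoprimeAway (π f h : R) : Prop := ∃ (k : ℕ) (u v : R), π ^ k = u * f + v * h

variable {π f h h' : R}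

theorem IsCoprimeAway.symm (H : IsCoprimeAway π f h) : IsCoprimeAway π h f := by
  obtain ⟨k, u, v, e⟩ := H
  exact ⟨k, v, u, by rw [e, add_comm]⟩

theorem IsCoprimeAway.one_right : IsCoprimeAway π f 1 := ⟨0, 0, 1, by simp⟩

theorem IsCoprimeAway.mul_right (H : IsCoprimeAway π f h) (H' : IsCoprimeAway π f h') :
    IsCoprimeAway π f (h * h') := by
  obtain ⟨k, u, v, e⟩ := H
  obtain ⟨j, u', v', e'⟩ := H'
  refine ⟨k + j, u * π ^ j + v * h * u', v * v', ?_⟩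
  calc π ^ (k + j) = π ^ k * π ^ j := pow_add ..
    _ = u * f * π ^ j + v * h * π ^ j := by rw [e]; ring
    _ = u * f * π ^ j + v * h * (u' * f + v' * h') := by rw [← e']
    _ = _ := by ring

theorem IsCoprimeAway.prod_right {ι : Type*} (s : Finset ι) (H : ι → R)
    (hs : ∀ i ∈ s, IsCoprimeAway π f (H i)) : IsCoprimeAway π f (∏ i ∈ s, H i) := by
  classical
  induction s using Finset.induction_on with
  | empty => simpa using IsCoprimeAway.one_right
  | insert i s hi ih =>
    rw [Finset.prod_insert hi]
    exact (hs i (by simp)).mul_right (ih fun j hj => hs j (by simp [hj]))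

theorem IsCoprimeAway.pow_left (H : IsCoprimeAway π f h) (n : ℕ) : IsCoprimeAway π (f ^ n) h := by
  simpa using (IsCoprimeAway.prod_right (Finset.range n) (fun _ => f) fun _ _ => H.symm).symm

end CoprimeAway

/-! ### Functionals on finitely generated modules -/

/-- A nontorsion element stays nonzero over the fraction field, where some functional detects it;
the denominators of that functional can be cleared on a finite set of generators. -/
theorem exists_smul_eq_zero_of_forall_dual {R M : Type*} [CommRing R] [IsDomain R]
    [AddCommGroup M] [Module R M] [Module.Finite R M] (x : M) (hx : ∀ f : M →ₗ[R] R, f x = 0) :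
    ∃ a : R, a ≠ 0 ∧ a • x = 0 := by
  classical
  by_contra! hcon
  let S := nonZeroDivisors R
  let ι := LocalizedModule.mkLinearMap S M
  have hι : ι x ≠ 0 := by
    intro h0
    obtain ⟨s, hs⟩ := (IsLocalizedModule.eq_zero_iff S ι).mp h0
    exact hcon s (nonZeroDivisors.ne_zero s.2) hs
  obtain ⟨F, hF⟩ := Module.Projective.exists_dual_ne_zero (FractionRing R) hι
  let h : M →ₗ[R] FractionRing R := F.restrictScalars R ∘ₗ ι
  obtain ⟨G, hG⟩ := Module.Finite.fg_top (R := R) (M := M)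
  obtain ⟨b, hb⟩ := IsLocalization.exist_integer_multiples_of_finset S (G.image h)
  have hrange : ∀ y, ((b : R) • h) y ∈ LinearMap.range (Algebra.linearMap R (FractionRing R)) := by
    intro y
    have hy : y ∈ Submodule.span R (G : Set M) := hG ▸ Submodule.mem_top
    induction hy using Submodule.span_induction with
    | mem y hy =>
      obtain ⟨c, hc⟩ := hb (h y) (Finset.mem_image_of_mem _ hy)
      exact ⟨c, hc⟩
    | zero => simp
    | add y z _ _ hy hz => rw [map_add]; exact add_mem hy hz
    | smul c y _ hy => rw [map_smul]; exact Submodule.smul_mem _ c hy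
  have hinj : Function.Injective (Algebra.linearMap R (FractionRing R)) :=
    IsFractionRing.injective R (FractionRing R)
  have h0 := hx ((LinearEquiv.ofInjective _ hinj).symm.toLinearMap ∘ₗ
    LinearMap.codRestrict _ ((b : R) • h) hrange)
  have h1 : ((b : R) • h) x = 0 := by
    rw [LinearMap.comp_apply, LinearEquiv.coe_coe, LinearEquiv.map_eq_zero_iff] at h0
    exact congrArg Subtype.val h0
  have h2 : (algebraMap R (FractionRing R) b) * h x = 0 := by
    rw [← Algebra.smul_def]; exact h1
  rcases mul_eq_zero.mp h2 with h3 | h3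
  · exact nonZeroDivisors.ne_zero b.2 (hinj (by rw [map_zero]; exact h3))
  · exact hF h3

/-! ### Arithmetic of the elements `ω_n` in `Λ` -/

section Elements

variable (p : ℕ) [Fact p.Prime]

/-- `Λ` is compact for the topology of coefficientwise convergence, so the infinitely many
equations can be solved together because any finitely many of them can. -/
theorem exists_forall_eq_add_mul_succ (z q : ℕ → Lam p) :
    ∃ s : ℕ → Lam p, ∀ n, s n = z n + q n * s (n + 1) := by
  open PowerSeries.WithPiTopology in
  have hc : CompactSpace (Lam p) :=
    inferInstanceAs (CompactSpace ((Unit →₀ ℕ) → ℤ_[p]))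
  let C : ℕ → Set (ℕ → Lam p) := fun N => {s | ∀ n < N, s n = z n + q n * s (n + 1)}
  have hne : ∀ (N : ℕ) (z q : ℕ → Lam p),
      ∃ s : ℕ → Lam p, ∀ n < N, s n = z n + q n * s (n + 1) := by
    intro N
    -- induction on `N` for all `z`, `q` at once: the shifted system has one equation less
    induction N with
    | zero => exact fun _ _ => ⟨0, by simp⟩
    | succ N ih =>
      intro z q
      obtain ⟨s, hs⟩ := ih (fun n => z (n + 1)) (fun n => q (n + 1))
      refine ⟨fun n => n.casesOn (z 0 + q 0 * s 0) s, fun n hn => ?_⟩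
      cases n with
      | zero => rfl
      | succ n => exact hs n (by omega)
  have hclosed : ∀ N, IsClosed (C N) := by
    intro N
    have : C N = ⋂ n, ⋂ (_ : n < N), {s | s n = z n + q n * s (n + 1)} := by
      ext s; simp [C]
    rw [this]
    refine isClosed_iInter fun n => isClosed_iInter fun _ => isClosed_eq (by fun_prop) ?_
    exact continuous_const.add (continuous_const.mul (continuous_apply _))
  -- `C (N + 1) ⊆ C N` are nonempty closed subsets of the compact space of sequences in `Λ`
  obtain ⟨s, hs⟩ := IsCompact.nonempty_iInter_of_sequence_nonempty_isCompact_isClosed C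
    (fun N s hs n hn => hs n (by omega)) (fun N => hne N z q) (hclosed 0).isCompact hclosed
  exact ⟨s, fun n => Set.mem_iInter.mp hs (n + 1) n (by omega)⟩

/-- The polynomial `(1 + X)^(p^n) - 1` of which `ω_n` is the image in `Λ`. -/
noncomputable def omegaPoly (n : ℕ) : Polynomial ℤ_[p] := (Polynomial.X + 1) ^ p ^ n - 1

theorem coe_omegaPoly (n : ℕ) : (omegaPoly p n : Lam p) = omega p n := by
  simp [omegaPoly, omega, add_comm]

theorem natDegree_X_add_one_pow (n : ℕ) :
    ((Polynomial.X + 1 : Polynomial ℤ_[p]) ^ p ^ n).natDegree = p ^ n := by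
  rw [← Polynomial.C_1, Polynomial.natDegree_pow, Polynomial.natDegree_X_add_C, mul_one]

theorem isDistinguishedAt_omegaPoly (n : ℕ) :
    (omegaPoly p n).IsDistinguishedAt (IsLocalRing.maximalIdeal ℤ_[p]) := by
  have hpos : 0 < p ^ n := pow_pos (Fact.out : p.Prime).pos n
  have hdeg := natDegree_X_add_one_pow p n
  have hmon : ((Polynomial.X + 1 : Polynomial ℤ_[p]) ^ p ^ n).Monic := by
    rw [← Polynomial.C_1]; exact (Polynomial.monic_X_add_C 1).pow _
  have hlt : (1 : Polynomial ℤ_[p]).degree <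
      ((Polynomial.X + 1 : Polynomial ℤ_[p]) ^ p ^ n).degree := by
    rw [Polynomial.degree_one, Polynomial.degree_eq_natDegree hmon.ne_zero, hdeg]
    exact_mod_cast hpos
  refine ⟨⟨fun {i} hi => ?_⟩, ?_⟩
  · rw [omegaPoly, Polynomial.natDegree_sub_eq_left_of_natDegree_lt (by simpa [hdeg]), hdeg] at hi
    rw [PadicInt.maximalIdeal_eq_span_p, Ideal.mem_span_singleton, omegaPoly, Polynomial.coeff_sub,
      Polynomial.coeff_X_add_one_pow, Polynomial.coeff_one]
    rcases eq_or_ne i 0 with rfl | h0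
    · simp
    · rw [if_neg h0, sub_zero]
      exact_mod_cast Nat.cast_dvd_cast
        ((Fact.out : p.Prime).dvd_choose_pow h0 hi.ne)
  · exact hmon.sub_of_left hlt

/-- By Weierstrass division, `Λ / (ω_n)` is a finite free `ℤ_p`-module. -/
theorem finite_free_quotient_omega (n : ℕ) :
    Module.Finite ℤ_[p] (Lam p ⧸ Ideal.span {omega p n}) ∧
      Module.Free ℤ_[p] (Lam p ⧸ Ideal.span {omega p n}) := by
  have H := isDistinguishedAt_omegaPoly p n
  have e := H.algEquivQuotient.toLinearEquiv
  rw [coe_omegaPoly] at e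
  have := H.monic.finite_quotient
  have := H.monic.free_quotient
  exact ⟨Module.Finite.equiv e, Module.Free.of_equiv e⟩

theorem omega_dvd_of_dvd_pow_mul {n k : ℕ} {x : Lam p} (h : omega p n ∣ (p : Lam p) ^ k * x) :
    omega p n ∣ x := by
  have := (finite_free_quotient_omega p n).2
  rw [← Ideal.mem_span_singleton, ← Ideal.Quotient.eq_zero_iff_mem] at h ⊢
  have h1 : ((p : ℤ_[p]) ^ k) • (Ideal.Quotient.mk (Ideal.span {omega p n}) x) = 0 := by
    rw [← h]
    change Ideal.Quotient.mk _ (((p : ℤ_[p]) ^ k) • x) = _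
    rw [PowerSeries.smul_eq_C_mul, map_pow, map_natCast]
  exact (smul_eq_zero.mp h1).resolve_left
    (pow_ne_zero _ (Nat.cast_ne_zero.mpr (Fact.out : p.Prime).ne_zero))

/-- A prime element `g` that shares no factor with `ω_n` acts injectively on the finite
`ℤ_p`-module `Λ / (ω_n)`, hence divides there a nonzero element of `ℤ_p`. -/
theorem isCoprimeAway_omega_of_prime {g : Lam p} (hg : Prime g) {n : ℕ}
    (hrel : IsRelPrime g (omega p n)) : IsCoprimeAway (p : Lam p) g (omega p n) := by
  have hfin := (finite_free_quotient_omega p n).1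
  set I := Ideal.span {omega p n} with hI
  have hndvd : ¬ g ∣ omega p n := fun hd => hg.not_isUnit (hrel dvd_rfl hd)
  have hreg : Ideal.Quotient.mk I g ∈ nonZeroDivisors (Lam p ⧸ I) := by
    rw [mem_nonZeroDivisors_iff_right]
    intro y hy
    obtain ⟨y, rfl⟩ := Ideal.Quotient.mk_surjective y
    rw [← map_mul, Ideal.Quotient.eq_zero_iff_mem, hI, Ideal.mem_span_singleton] at hy
    rw [Ideal.Quotient.eq_zero_iff_mem, hI, Ideal.mem_span_singleton]
    obtain ⟨u, hu⟩ := hy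
    obtain ⟨w, rfl⟩ : g ∣ u :=
      (hg.dvd_or_dvd (hu ▸ dvd_mul_left g y : g ∣ omega p n * u)).resolve_left hndvd
    refine ⟨w, mul_right_cancel₀ hg.ne_zero ?_⟩
    rw [hu]; ring
  obtain ⟨r, hr, hd⟩ := (Algebra.IsIntegral.isIntegral (R := ℤ_[p])
    (Ideal.Quotient.mk I g)).isAlgebraic.exists_nonzero_dvd hreg
  obtain ⟨y, hy⟩ := hd
  obtain ⟨y, rfl⟩ := Ideal.Quotient.mk_surjective y
  have h1 : PowerSeries.C r - g * y ∈ I := by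
    rw [← Ideal.Quotient.eq_zero_iff_mem, map_sub, map_mul, ← hy, sub_eq_zero]
    rfl
  obtain ⟨v, hv⟩ := Ideal.mem_span_singleton.mp h1
  -- a nonzero element of `ℤ_p` is a unit times a power of `p`
  have hr' := PadicInt.unitCoeff_spec hr
  set ε := PadicInt.unitCoeff hr
  have h2 : PowerSeries.C r = PowerSeries.C (ε : ℤ_[p]) * (p : Lam p) ^ r.valuation := by
    conv_lhs => rw [hr']
    simp
  have h3 : PowerSeries.C ((ε⁻¹ : ℤ_[p]ˣ) : ℤ_[p]) * PowerSeries.C (ε : ℤ_[p]) = 1 := by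
    rw [← map_mul]; simp
  refine ⟨r.valuation, PowerSeries.C ((ε⁻¹ : ℤ_[p]ˣ) : ℤ_[p]) * y,
    PowerSeries.C ((ε⁻¹ : ℤ_[p]ˣ) : ℤ_[p]) * v, ?_⟩
  have h4 : PowerSeries.C r = y * g + v * omega p n := by linear_combination hv
  calc (p : Lam p) ^ r.valuation
      = PowerSeries.C ((ε⁻¹ : ℤ_[p]ˣ) : ℤ_[p]) * PowerSeries.C r := by
        rw [h2, ← mul_assoc, h3, one_mul]
    _ = _ := by rw [h4]; ring

theorem omega_eq_prod_omegaStep (n : ℕ) :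
    omega p n = ∏ i ∈ Finset.range (n + 1), omegaStep p i := by
  induction n with
  | zero => simp [omegaStep]
  | succ n ih => rw [Finset.prod_range_succ, ← ih, ← omega_mul_omegaQuot, omegaStep]

theorem omegaStep_dvd_omega {a n : ℕ} (h : a ≤ n) : omegaStep p a ∣ omega p n := by
  rw [omega_eq_prod_omegaStep]
  exact Finset.dvd_prod_of_mem _ (Finset.mem_range.mpr (by omega))

theorem omegaStep_ne_zero (a : ℕ) : omegaStep p a ≠ 0 := fun h =>
  omega_ne_zero p a (zero_dvd_iff.mp (h ▸ omegaStep_dvd_omega p le_rfl))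

theorem omegaStep_dvd_of_dvd_pow_mul {a k : ℕ} {x : Lam p}
    (h : omegaStep p a ∣ (p : Lam p) ^ k * x) : omegaStep p a ∣ x := by
  obtain ⟨c, hc⟩ := omegaStep_dvd_omega p (le_refl a)
  have hc0 : c ≠ 0 := fun h0 => omega_ne_zero p a (by rw [hc, h0, mul_zero])
  have : omega p a ∣ (p : Lam p) ^ k * (x * c) := by
    rw [hc, ← mul_assoc]; exact mul_dvd_mul_right h c
  have := omega_dvd_of_dvd_pow_mul p this
  rw [hc] at this
  exact (mul_dvd_mul_iff_right hc0).mp this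

/-- Modulo `ω_n` each of the `p` summands of `ω_{n+1,n}` is `1`. -/
theorem omega_dvd_omegaQuot_sub (n : ℕ) : omega p n ∣ omegaQuot p n - p := by
  have : omegaQuot p n - p = ∑ i ∈ Finset.range p, (((1 + PowerSeries.X) ^ p ^ n) ^ i - 1) := by
    simp [omegaQuot]
  rw [this]
  exact Finset.dvd_sum fun i _ => sub_one_dvd_pow_sub_one _ i

theorem isCoprimeAway_omegaStep_of_lt {a b : ℕ} (h : a < b) :
    IsCoprimeAway (p : Lam p) (omegaStep p a) (omegaStep p b) := by
  obtain ⟨b, rfl⟩ : ∃ c, b = c + 1 := ⟨b - 1, by omega⟩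
  obtain ⟨c, hc⟩ := (omegaStep_dvd_omega p (by omega : a ≤ b)).trans (omega_dvd_omegaQuot_sub p b)
  exact ⟨1, -c, 1, by rw [omegaStep]; linear_combination -hc⟩

theorem isCoprimeAway_omegaStep {a b : ℕ} (h : a ≠ b) :
    IsCoprimeAway (p : Lam p) (omegaStep p a) (omegaStep p b) :=
  h.lt_or_gt.elim (isCoprimeAway_omegaStep_of_lt p) fun h =>
    (isCoprimeAway_omegaStep_of_lt p h).symm

theorem exists_omega_eq_omegaStep_mul {a n : ℕ} (h : a ≤ n) :
    ∃ c, omega p n = omegaStep p a * c ∧ IsCoprimeAway (p : Lam p) (omegaStep p a) c := by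
  refine ⟨∏ i ∈ (Finset.range (n + 1)).erase a, omegaStep p i, ?_, ?_⟩
  · rw [omega_eq_prod_omegaStep, Finset.mul_prod_erase _ _ (Finset.mem_range.mpr (by omega))]
  · exact IsCoprimeAway.prod_right _ _ fun i hi =>
      isCoprimeAway_omegaStep p (Finset.ne_of_mem_erase hi).symm

theorem natCast_mem_maximalIdeal : (p : Lam p) ∈ IsLocalRing.maximalIdeal (Lam p) := by
  rw [IsLocalRing.mem_maximalIdeal, mem_nonunits_iff, PowerSeries.isUnit_iff_constantCoeff]
  simpa using PadicInt.p_nonunit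

theorem omegaStep_mem_maximalIdeal (a : ℕ) :
    omegaStep p a ∈ IsLocalRing.maximalIdeal (Lam p) := by
  have h0 : omega p 0 ∈ IsLocalRing.maximalIdeal (Lam p) := by
    rw [omega_zero, IsLocalRing.mem_maximalIdeal, mem_nonunits_iff,
      PowerSeries.isUnit_iff_constantCoeff]
    simp
  cases a with
  | zero => exact h0
  | succ a =>
    have h1 := Ideal.mem_of_dvd _ (omega_dvd p (Nat.zero_le a)) h0
    have h2 := Ideal.mem_of_dvd _ (omega_dvd_omegaQuot_sub p a) h1
    rw [omegaStep, ← sub_add_cancel (omegaQuot p a) (p : Lam p)]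
    exact add_mem h2 (natCast_mem_maximalIdeal p)

theorem omega_mem_maximalIdeal_pow (n : ℕ) :
    omega p n ∈ IsLocalRing.maximalIdeal (Lam p) ^ n := by
  refine Ideal.pow_le_pow_right (Nat.le_succ n) ?_
  rw [omega_eq_prod_omegaStep]
  simpa using Ideal.prod_mem_prod (s := Finset.range (n + 1))
    (I := fun _ => IsLocalRing.maximalIdeal (Lam p)) fun i _ => omegaStep_mem_maximalIdeal p i

end Elements

/-! ### Representing `𝔊(M)` by a submodule of `M` -/

section Modules

variable (p : ℕ) [Fact p.Prime] (M : Type*) [AddCommGroup M] [Module (Lam p) M]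

theorem mem_omegaSub {M : Type*} [AddCommGroup M] [Module (Lam p) M] {n : ℕ} {x : M} :
    x ∈ omegaSub p M n ↔ ∃ y, omega p n • y = x := Iff.rfl

/-- The submodule of those `x` in `M` whose image in `M / ω_n M` is killed by a power of `p` for
every `n`. For finitely generated `M` it is a copy of `𝔊(M)` inside `M`, see `frakGSubEquiv`. -/
noncomputable def frakGSub : Submodule (Lam p) M :=
  ⨅ n, (pPrimary p (M ⧸ omegaSub p M n)).comap (omegaSub p M n).mkQ

variable {M}

theorem mem_pPrimary {x : M} : x ∈ pPrimary p M ↔ ∃ k : ℕ, (p : Lam p) ^ k • x = 0 := by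
  rw [pPrimary, Submodule.mem_torsion'_iff]
  constructor
  · rintro ⟨⟨_, k, rfl⟩, h⟩
    exact ⟨k, h⟩
  · rintro ⟨k, h⟩
    exact ⟨⟨_, k, rfl⟩, h⟩

theorem mem_frakGSub {x : M} :
    x ∈ frakGSub p M ↔ ∀ n, ∃ (k : ℕ) (y : M), (p : Lam p) ^ k • x = omega p n • y := by
  rw [frakGSub, Submodule.mem_iInf]
  refine forall_congr' fun n => ?_
  rw [Submodule.mem_comap, mem_pPrimary]
  refine exists_congr fun k => ?_
  rw [← map_smul, Submodule.mkQ_apply, Submodule.Quotient.mk_eq_zero, mem_omegaSub]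
  simp only [eq_comm]

/-- Membership has to be tested for large `n` only, because `ω_m` divides `ω_n` for `m ≤ n`. -/
theorem mem_frakGSub_of_le {x : M} (a : ℕ)
    (h : ∀ n, a ≤ n → ∃ (k : ℕ) (y : M), (p : Lam p) ^ k • x = omega p n • y) :
    x ∈ frakGSub p M := by
  rw [mem_frakGSub]
  intro n
  obtain ⟨k, y, hy⟩ := h (max a n) (le_max_left _ _)
  obtain ⟨c, hc⟩ := omega_dvd p (le_max_right a n)
  exact ⟨k, c • y, by rw [hy, hc, mul_smul]⟩

variable {N : Type*} [AddCommGroup N] [Module (Lam p) N]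

theorem map_mem_frakGSub (f : M →ₗ[Lam p] N) {x : M} (hx : x ∈ frakGSub p M) :
    f x ∈ frakGSub p N := by
  rw [mem_frakGSub] at hx ⊢
  intro n
  obtain ⟨k, y, hy⟩ := hx n
  exact ⟨k, f y, by rw [← map_smul, hy, map_smul]⟩

theorem mem_frakGSub_prod {x : M × N} :
    x ∈ frakGSub p (M × N) ↔ x.1 ∈ frakGSub p M ∧ x.2 ∈ frakGSub p N := by
  refine ⟨fun h => ⟨map_mem_frakGSub p (LinearMap.fst _ M N) h,
    map_mem_frakGSub p (LinearMap.snd _ M N) h⟩, fun ⟨h1, h2⟩ => ?_⟩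
  have := add_mem (map_mem_frakGSub p (LinearMap.inl (Lam p) M N) h1)
    (map_mem_frakGSub p (LinearMap.inr (Lam p) M N) h2)
  simpa using this

theorem mem_frakGSub_pi {ι : Type*} [Finite ι] {Q : ι → Type*} [∀ i, AddCommGroup (Q i)]
    [∀ i, Module (Lam p) (Q i)] {x : (i : ι) → Q i} :
    x ∈ frakGSub p ((i : ι) → Q i) ↔ ∀ i, x i ∈ frakGSub p (Q i) := by
  classical
  have := Fintype.ofFinite ι
  refine ⟨fun h i => map_mem_frakGSub p (LinearMap.proj i) h, fun h => ?_⟩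
  have hs : x = ∑ i, LinearMap.single (Lam p) Q i (x i) := by
    ext j; simp [Finset.sum_apply]
  rw [hs]
  exact sum_mem fun i _ => map_mem_frakGSub p _ (h i)

/-- An element of `frakGSub p M` gives the compatible sequence of its residue classes. -/
noncomputable def frakGSubToFrakG (p : ℕ) [Fact p.Prime] (M : Type*) [AddCommGroup M]
    [Module (Lam p) M] : frakGSub p M →ₗ[Lam p] frakG p M :=
  LinearMap.codRestrict _
    ((LinearMap.pi fun n => (omegaSub p M n).mkQ) ∘ₗ (frakGSub p M).subtype) fun x =>
      ⟨fun n => (Submodule.mem_iInf _).mp x.2 n, fun _ _ _ => rfl⟩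

theorem frakGSubToFrakG_apply (x : frakGSub p M) (n : ℕ) :
    (frakGSubToFrakG p M x : (n : ℕ) → M ⧸ omegaSub p M n) n =
      Submodule.Quotient.mk (x : M) := rfl

section Finite

variable [Module.Finite (Lam p) M]

theorem eq_zero_of_forall_mem_omegaSub {x : M} (h : ∀ n, x ∈ omegaSub p M n) : x = 0 := by
  have hK := Ideal.iInf_pow_smul_eq_bot_of_isLocalRing (M := M)
    (IsLocalRing.maximalIdeal (Lam p)) (IsLocalRing.maximalIdeal.isMaximal _).ne_top
  rw [← Submodule.mem_bot (R := Lam p), ← hK, Submodule.mem_iInf]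
  intro n
  obtain ⟨y, rfl⟩ := h n
  exact Submodule.smul_mem_smul (omega_mem_maximalIdeal_pow p n) Submodule.mem_top

/-- The module form of `exists_forall_eq_add_mul_succ`. -/
theorem exists_forall_eq_add_smul_succ (z : ℕ → M) (q : ℕ → Lam p) :
    ∃ s : ℕ → M, ∀ n, s n = z n + q n • s (n + 1) := by
  obtain ⟨r, f, hf⟩ := Module.Finite.exists_fin' (Lam p) M
  choose w hw using fun n => hf (z n)
  choose s hs using fun i => exists_forall_eq_add_mul_succ p (fun n => w n i) q
  refine ⟨fun n => f fun i => s i n, fun n => ?_⟩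
  rw [← hw, ← map_smul, ← map_add]
  exact congrArg f (funext fun i => hs i n)

/-- A compatible sequence `y_n` with `y_{n+1} = y_n + ω_n z_n` is represented by
`y_0 + ω_0 s_0` as soon as `s_n = z_n + ω_{n+1,n} s_{n+1}` for all `n`. -/
theorem exists_forall_sub_mem_omegaSub (y : ℕ → M)
    (hy : ∀ n, y (n + 1) - y n ∈ omegaSub p M n) : ∃ x : M, ∀ n, x - y n ∈ omegaSub p M n := by
  choose z hz using fun n => (mem_omegaSub p).mp (hy n)
  obtain ⟨s, hs⟩ := exists_forall_eq_add_smul_succ p z (omegaQuot p)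
  refine ⟨y 0 + omega p 0 • s 0, fun n => (mem_omegaSub p).mpr ⟨s n, ?_⟩⟩
  have key : y 0 + omega p 0 • s 0 = y n + omega p n • s n := by
    induction n with
    | zero => rfl
    | succ n ih =>
      rw [ih, hs n, smul_add, hz, ← mul_smul, omega_mul_omegaQuot]
      abel
  rw [key, add_sub_cancel_left]

theorem frakGSubToFrakG_bijective : Function.Bijective (frakGSubToFrakG p M) := by
  constructor
  · refine (injective_iff_map_eq_zero _).mpr fun x hx => ?_
    refine Subtype.ext (eq_zero_of_forall_mem_omegaSub p fun n => ?_)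
    rw [← Submodule.Quotient.mk_eq_zero, ← frakGSubToFrakG_apply, hx]
    rfl
  · rintro ⟨x, hx, hcomp⟩
    choose y hy using fun n => Submodule.Quotient.mk_surjective _ (x n)
    obtain ⟨m, hm⟩ := exists_forall_sub_mem_omegaSub p y fun n => by
      rw [← Submodule.Quotient.eq, hy n, ← hcomp n (n + 1) (Nat.le_succ n), ← hy (n + 1)]
      rfl
    have hmx : ∀ n, (Submodule.Quotient.mk m : M ⧸ omegaSub p M n) = x n := fun n => by
      rw [← hy n, Submodule.Quotient.eq]; exact hm n
    refine ⟨⟨m, (Submodule.mem_iInf _).mpr fun n => ?_⟩, Subtype.ext (funext hmx)⟩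
    rw [Submodule.mem_comap, Submodule.mkQ_apply, hmx]
    exact hx n

/-- For finitely generated `M`, the submodule `frakGSub p M` of `M` is isomorphic to `𝔊(M)`. -/
noncomputable def frakGSubEquiv (p : ℕ) [Fact p.Prime] (M : Type*) [AddCommGroup M]
    [Module (Lam p) M] [Module.Finite (Lam p) M] : frakGSub p M ≃ₗ[Lam p] frakG p M :=
  LinearEquiv.ofBijective (frakGSubToFrakG p M) (frakGSubToFrakG_bijective p)

end Finite

/-! ### Pseudo-isomorphisms -/

/-- Finite `Λ`-modules are `p`-primary: if `p^i x = p^j x` with `i < j`, then `p^i x = 0` because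
`1 - p^(j-i)` is a unit. -/
theorem exists_pow_smul_eq_zero_of_finite [Finite M] (x : M) :
    ∃ k : ℕ, (p : Lam p) ^ k • x = 0 := by
  obtain ⟨i, j, hij, h⟩ : ∃ i j : ℕ, i < j ∧ (p : Lam p) ^ i • x = (p : Lam p) ^ j • x := by
    obtain ⟨i, j, hne, h⟩ := Finite.exists_ne_map_eq_of_infinite fun i : ℕ => (p : Lam p) ^ i • x
    rcases hne.lt_or_gt with hl | hl
    · exact ⟨i, j, hl, h⟩
    · exact ⟨j, i, hl, h.symm⟩
  refine ⟨i, ?_⟩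
  have hu : IsUnit (1 - (p : Lam p) ^ (j - i)) :=
    IsLocalRing.isUnit_one_sub_self_of_mem_nonunits _
      ((IsLocalRing.mem_maximalIdeal _).mp
        (Ideal.pow_mem_of_mem _ (natCast_mem_maximalIdeal p) _ (by omega)))
  rw [← hu.smul_eq_zero, sub_smul, one_smul, ← mul_smul, ← pow_add,
    Nat.sub_add_cancel hij.le, h, sub_self]

/-- The restriction of a linear map `M → N` to the submodules `frakGSub`. -/
noncomputable def frakGSubMap (f : M →ₗ[Lam p] N) : frakGSub p M →ₗ[Lam p] frakGSub p N :=
  f.restrict fun _ => map_mem_frakGSub p f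

theorem frakGMap_frakGSubToFrakG (f : M →ₗ[Lam p] N) (x : frakGSub p M) :
    frakGMap p f (frakGSubToFrakG p M x) = frakGSubToFrakG p N (frakGSubMap p f x) := rfl

/-- The denominators introduced by the finite kernel and cokernel are powers of `p`. -/
theorem mem_frakGSub_of_map_mem {f : M →ₗ[Lam p] N} (hf : IsPseudoIso f) {x : M}
    (hx : f x ∈ frakGSub p N) : x ∈ frakGSub p M := by
  have := hf.1
  have := hf.2
  rw [mem_frakGSub] at hx ⊢
  intro n
  obtain ⟨k, y, hy⟩ := hx n
  obtain ⟨c, hc⟩ := exists_pow_smul_eq_zero_of_finite p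
    (Submodule.Quotient.mk y : N ⧸ LinearMap.range f)
  rw [← Submodule.Quotient.mk_smul, Submodule.Quotient.mk_eq_zero] at hc
  obtain ⟨w, hw⟩ := hc
  have hker : (p : Lam p) ^ (c + k) • x - omega p n • w ∈ LinearMap.ker f := by
    rw [LinearMap.mem_ker, map_sub, map_smul, map_smul, hw, pow_add, mul_smul, hy,
      smul_comm (omega p n), sub_self]
  obtain ⟨d, hd⟩ := exists_pow_smul_eq_zero_of_finite p (⟨_, hker⟩ : LinearMap.ker f)
  refine ⟨d + (c + k), (p : Lam p) ^ d • w, ?_⟩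
  have hd' : (p : Lam p) ^ d • ((p : Lam p) ^ (c + k) • x - omega p n • w) = 0 :=
    congrArg Subtype.val hd
  rw [smul_sub, sub_eq_zero] at hd'
  rw [pow_add, mul_smul, hd', smul_comm]

theorem isPseudoIso_frakGSubMap {f : M →ₗ[Lam p] N} (hf : IsPseudoIso f) :
    IsPseudoIso (frakGSubMap p f) := by
  have := hf.1
  have := hf.2
  constructor
  · refine Finite.of_injective (β := LinearMap.ker f)
      (fun x => ⟨x.1.1, congrArg Subtype.val (LinearMap.mem_ker.mp x.2)⟩) ?_
    intro x y h
    exact Subtype.ext (Subtype.ext (Subtype.mk.inj h))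
  · let F : (frakGSub p N ⧸ LinearMap.range (frakGSubMap p f)) →ₗ[Lam p]
        (N ⧸ LinearMap.range f) :=
      Submodule.mapQ _ _ (frakGSub p N).subtype (by
        rintro _ ⟨x, rfl⟩
        exact ⟨x.1, rfl⟩)
    refine Finite.of_injective F ?_
    rw [← LinearMap.ker_eq_bot, LinearMap.ker_eq_bot']
    intro y hy
    obtain ⟨y, rfl⟩ := Submodule.Quotient.mk_surjective _ y
    obtain ⟨x, hx⟩ : (y : N) ∈ LinearMap.range f :=
      (Submodule.Quotient.mk_eq_zero _).mp hy
    rw [Submodule.Quotient.mk_eq_zero]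
    exact ⟨⟨x, mem_frakGSub_of_map_mem p hf (hx ▸ y.2)⟩, Subtype.ext hx⟩

/-- Pseudo-isomorphisms are invariant under isomorphisms of source and target. -/
theorem IsPseudoIso.of_equiv {M' N' : Type*} [AddCommMonoid M'] [Module (Lam p) M']
    [AddCommGroup N'] [Module (Lam p) N'] {f : M →ₗ[Lam p] N} (hf : IsPseudoIso f)
    {f' : M' →ₗ[Lam p] N'} (e : M ≃ₗ[Lam p] M') (e' : N ≃ₗ[Lam p] N')
    (h : ∀ x, f' (e x) = e' (f x)) : IsPseudoIso f' := by
  have := hf.1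
  have := hf.2
  constructor
  · refine Finite.of_injective (β := LinearMap.ker f) (fun x => ⟨e.symm x.1, ?_⟩) ?_
    · rw [LinearMap.mem_ker, ← e'.map_eq_zero_iff, ← h, e.apply_symm_apply]
      exact x.2
    · intro x y hxy
      exact Subtype.ext (e.symm.injective (congrArg Subtype.val hxy))
  · refine Finite.of_equiv _ (Submodule.Quotient.equiv (LinearMap.range f) (LinearMap.range f')
      e' ?_).toEquiv
    ext y
    constructor
    · rintro ⟨_, ⟨x, rfl⟩, rfl⟩
      exact ⟨e x, h x⟩
    · rintro ⟨x, rfl⟩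
      exact ⟨f (e.symm x), ⟨_, rfl⟩, by
        rw [← e.apply_symm_apply x, h, e.apply_symm_apply]; rfl⟩

theorem isPseudoIso_comp_frakGMap [Module.Finite (Lam p) M] [Module.Finite (Lam p) N]
    {f : M →ₗ[Lam p] N} (hf : IsPseudoIso f) {P : Type*} [AddCommGroup P] [Module (Lam p) P]
    (e : frakGSub p N ≃ₗ[Lam p] P) :
    IsPseudoIso (((frakGSubEquiv p N).symm.trans e).toLinearMap ∘ₗ frakGMap p f) := by
  refine (isPseudoIso_frakGSubMap p hf).of_equiv p (frakGSubEquiv p M) e fun x => ?_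
  have hx : frakGMap p f (frakGSubEquiv p M x) = frakGSubEquiv p N (frakGSubMap p f x) :=
    frakGMap_frakGSubToFrakG p f x
  rw [LinearMap.comp_apply, hx, LinearEquiv.coe_coe, LinearEquiv.trans_apply,
    LinearEquiv.symm_apply_apply]

/-! ### The submodule for `Λ` and its cyclic quotients -/

theorem frakGSub_self : frakGSub p (Lam p) = ⊥ := by
  rw [eq_bot_iff]
  intro x hx
  rw [mem_frakGSub] at hx
  refine eq_zero_of_forall_mem_omegaSub p fun n => ?_
  obtain ⟨k, y, hy⟩ := hx n
  obtain ⟨c, hc⟩ := omega_dvd_of_dvd_pow_mul p (Dvd.intro y hy.symm)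
  exact ⟨c, hc.symm⟩

theorem isTorsion_frakGSub [Module.Finite (Lam p) M] :
    Module.IsTorsion (Lam p) (frakGSub p M) := by
  rintro ⟨x, hx⟩
  obtain ⟨a, ha, hax⟩ := exists_smul_eq_zero_of_forall_dual (R := Lam p) x fun f => by
    have := map_mem_frakGSub p f hx
    rwa [frakGSub_self, Submodule.mem_bot] at this
  exact ⟨⟨a, mem_nonZeroDivisors_of_ne_zero ha⟩, Subtype.ext hax⟩

theorem isTorsion_frakG [Module.Finite (Lam p) M] : Module.IsTorsion (Lam p) (frakG p M) := by
  intro x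
  obtain ⟨c, hc⟩ := isTorsion_frakGSub p (x := (frakGSubEquiv p M).symm x)
  refine ⟨c, (frakGSubEquiv p M).symm.injective ?_⟩
  rw [map_zero, ← hc]
  exact map_smul (frakGSubEquiv p M).symm (c : Lam p) x

theorem frakGSub_quotient_eq_top {q : Lam p}
    (hq : ∀ n, IsCoprimeAway (p : Lam p) q (omega p n)) :
    frakGSub p (Lam p ⧸ Ideal.span {q}) = ⊤ := by
  rw [eq_top_iff]
  rintro x -
  rw [mem_frakGSub]
  intro n
  obtain ⟨x, rfl⟩ := Ideal.Quotient.mk_surjective x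
  obtain ⟨k, u, v, h⟩ := hq n
  refine ⟨k, Ideal.Quotient.mk _ (v * x), ?_⟩
  change Ideal.Quotient.mk _ ((p : Lam p) ^ k * x) = Ideal.Quotient.mk _ (omega p n * (v * x))
  rw [Ideal.Quotient.eq, Ideal.mem_span_singleton]
  exact ⟨u * x, by rw [h]; ring⟩

/-- Multiplication by `w`, as a map `Λ/(w^(e-1)) → Λ/(w^e)`. -/
noncomputable def mulQuotPow {p : ℕ} [Fact p.Prime] (w : Lam p) {e : ℕ} (he : 1 ≤ e) :
    (Lam p ⧸ Ideal.span {w ^ (e - 1)}) →ₗ[Lam p] (Lam p ⧸ Ideal.span {w ^ e}) :=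
  Submodule.mapQ _ _ (LinearMap.lsmul (Lam p) (Lam p) w) (by
    intro x hx
    obtain ⟨c, rfl⟩ := Ideal.mem_span_singleton.mp hx
    refine Ideal.mem_span_singleton.mpr ⟨c, ?_⟩
    obtain ⟨e, rfl⟩ : ∃ k, e = k + 1 := ⟨e - 1, by omega⟩
    simp only [LinearMap.lsmul_apply, smul_eq_mul, Nat.add_sub_cancel]
    ring)

theorem mulQuotPow_mk {w : Lam p} {e : ℕ} (he : 1 ≤ e) (x : Lam p) :
    mulQuotPow w he (Ideal.Quotient.mk _ x) = Ideal.Quotient.mk _ (w * x) := rfl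

theorem mulQuotPow_injective {w : Lam p} (hw : w ≠ 0) {e : ℕ} (he : 1 ≤ e) :
    Function.Injective (mulQuotPow w he) := by
  rw [← LinearMap.ker_eq_bot, LinearMap.ker_eq_bot']
  intro x hx
  obtain ⟨x, rfl⟩ := Ideal.Quotient.mk_surjective x
  rw [mulQuotPow_mk, Ideal.Quotient.eq_zero_iff_mem, Ideal.mem_span_singleton] at hx
  rw [Ideal.Quotient.eq_zero_iff_mem, Ideal.mem_span_singleton]
  obtain ⟨e, rfl⟩ : ∃ k, e = k + 1 := ⟨e - 1, by omega⟩
  rw [pow_succ'] at hx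
  exact (mul_dvd_mul_iff_left hw).mp hx

/-- For large `n` write `ω_n = w c`, where `w = ω_{a,a-1}` and `w`, `c` are coprime after `p` is
inverted. Then `p^k w y` is a multiple of `ω_n` modulo `w^e` because some `p^k` lies in
`(w^(e-1), c)`; conversely every element of the submodule lies in `(w)`, modulo which `p` acts
injectively. -/
theorem frakGSub_quotient_omegaStep_pow (a : ℕ) {e : ℕ} (he : 1 ≤ e) :
    frakGSub p (Lam p ⧸ Ideal.span {omegaStep p a ^ e}) =
      LinearMap.range (mulQuotPow (omegaStep p a) he) := by
  set w := omegaStep p a with hw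
  have hpow : w ^ e = w * w ^ (e - 1) := by
    rw [← pow_succ', Nat.sub_add_cancel he]
  apply le_antisymm
  · intro x hx
    obtain ⟨x, rfl⟩ := Ideal.Quotient.mk_surjective x
    obtain ⟨k, y, hy⟩ := (mem_frakGSub p).mp hx a
    obtain ⟨y, rfl⟩ := Ideal.Quotient.mk_surjective y
    have hmem : (p : Lam p) ^ k * x - omega p a * y ∈ Ideal.span {w ^ e} :=
      Ideal.Quotient.eq.mp hy
    have h1 : w ∣ (p : Lam p) ^ k * x - omega p a * y :=
      (Dvd.intro _ hpow.symm).trans (Ideal.mem_span_singleton.mp hmem)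
    have h2 : w ∣ (p : Lam p) ^ k * x :=
      (dvd_sub_left ((omegaStep_dvd_omega p le_rfl).mul_right y)).mp h1
    obtain ⟨c, rfl⟩ := omegaStep_dvd_of_dvd_pow_mul p h2
    exact ⟨Ideal.Quotient.mk _ c, rfl⟩
  · rintro _ ⟨y, rfl⟩
    obtain ⟨y, rfl⟩ := Ideal.Quotient.mk_surjective y
    refine mem_frakGSub_of_le p a fun n hn => ?_
    obtain ⟨c, hc, hcop⟩ := exists_omega_eq_omegaStep_mul p hn
    obtain ⟨k, u, v, h⟩ := hcop.pow_left (e - 1)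
    refine ⟨k, Ideal.Quotient.mk _ (v * y), ?_⟩
    change Ideal.Quotient.mk _ ((p : Lam p) ^ k * (w * y)) =
      Ideal.Quotient.mk _ (omega p n * (v * y))
    rw [Ideal.Quotient.eq, Ideal.mem_span_singleton]
    exact ⟨u * y, by rw [h, hpow, hc]; ring⟩

theorem frakGSub_quotient_omegaStep (b : ℕ) :
    frakGSub p (Lam p ⧸ Ideal.span {omegaStep p b}) = ⊥ := by
  rw [eq_bot_iff]
  intro x hx
  obtain ⟨x, rfl⟩ := Ideal.Quotient.mk_surjective x
  obtain ⟨k, y, hy⟩ := (mem_frakGSub p).mp hx b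
  obtain ⟨y, rfl⟩ := Ideal.Quotient.mk_surjective y
  have hmem : (p : Lam p) ^ k * x - omega p b * y ∈ Ideal.span {omegaStep p b} :=
    Ideal.Quotient.eq.mp hy
  rw [Submodule.mem_bot, Ideal.Quotient.eq_zero_iff_mem, Ideal.mem_span_singleton]
  exact omegaStep_dvd_of_dvd_pow_mul p ((dvd_sub_left
    ((omegaStep_dvd_omega p le_rfl).mul_right y)).mp (Ideal.mem_span_singleton.mp hmem))

/-! ### Elementary modules -/

variable {r d f t : ℕ} {g : Fin d → Lam p} {l : Fin d → ℕ} {a e : Fin f → ℕ} {b : Fin t → ℕ}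

/-- The embedding `(u, v) ↦ (0, u, (ω_{a_m,a_m-1} v_m)_m, 0)` into the elementary module. -/
noncomputable def toElementary (r : ℕ) (g : Fin d → Lam p) (l : Fin d → ℕ) (a : Fin f → ℕ)
    {e : Fin f → ℕ} (b : Fin t → ℕ) (he : ∀ m, 1 ≤ e m) :
    (CyclicSum (fun i => g i ^ l i) × CyclicSum (fun m => omegaStep p (a m) ^ (e m - 1)))
      →ₗ[Lam p] Elementary p r g l a e b :=
  LinearMap.inr (Lam p) _ _ ∘ₗ
    (LinearMap.id.prodMap (LinearMap.inl (Lam p) _ _ ∘ₗ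
      LinearMap.piMap fun m => mulQuotPow (omegaStep p (a m)) (he m)))

theorem toElementary_apply (he : ∀ m, 1 ≤ e m) (u : CyclicSum (fun i => g i ^ l i))
    (v : CyclicSum (fun m => omegaStep p (a m) ^ (e m - 1))) :
    toElementary p r g l a b he (u, v) =
      (0, u, (fun m => mulQuotPow (omegaStep p (a m)) (he m) (v m)), 0) := rfl

theorem toElementary_injective (he : ∀ m, 1 ≤ e m) :
    Function.Injective (toElementary p r g l a b he) := by
  rintro ⟨u, v⟩ ⟨u', v'⟩ h
  simp only [toElementary_apply, Prod.mk.injEq, true_and, and_true] at h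
  refine Prod.ext h.1 (funext fun m => ?_)
  exact mulQuotPow_injective p (omegaStep_ne_zero p (a m)) (he m) (congrFun h.2 m)

theorem range_toElementary (hg : ∀ i, Prime (g i)) (hrel : ∀ i n, IsRelPrime (g i) (omega p n))
    (he : ∀ m, 1 ≤ e m) :
    LinearMap.range (toElementary p r g l a b he) =
      frakGSub p (Elementary p r g l a e b) := by
  have hmem : ∀ x : Elementary p r g l a e b, x ∈ frakGSub p (Elementary p r g l a e b) ↔
      x.1 = 0 ∧ (∀ m, x.2.2.1 m ∈ LinearMap.range (mulQuotPow (omegaStep p (a m)) (he m))) ∧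
        x.2.2.2 = 0 := by
    intro x
    have htop : ∀ i, frakGSub p (Lam p ⧸ Ideal.span {g i ^ l i}) = ⊤ := fun i =>
      frakGSub_quotient_eq_top p fun n =>
        (isCoprimeAway_omega_of_prime p (hg i) (hrel i n)).pow_left _
    simp only [mem_frakGSub_prod, mem_frakGSub_pi, frakGSub_self, htop,
      frakGSub_quotient_omegaStep, frakGSub_quotient_omegaStep_pow p _ (he _),
      Submodule.mem_bot, Submodule.mem_top, implies_true, true_and, funext_iff, Pi.zero_apply]
  ext x
  rw [hmem]
  constructor
  · rintro ⟨⟨u, v⟩, rfl⟩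
    exact ⟨rfl, fun m => ⟨v m, rfl⟩, rfl⟩
  · rintro ⟨h1, h2, h3⟩
    choose v hv using h2
    exact ⟨(x.2.1, v), Prod.ext h1.symm (Prod.ext rfl (Prod.ext (funext hv) h3.symm))⟩

/-- For an elementary module `E`, the submodule `frakGSub p E` as a sum of cyclic modules. -/
noncomputable def frakGSubElementaryEquiv (hg : ∀ i, Prime (g i))
    (hrel : ∀ i n, IsRelPrime (g i) (omega p n)) (he : ∀ m, 1 ≤ e m) :
    frakGSub p (Elementary p r g l a e b) ≃ₗ[Lam p]
      CyclicSum (fun i => g i ^ l i) × CyclicSum (fun m => omegaStep p (a m) ^ (e m - 1)) :=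
  ((LinearEquiv.ofInjective _ (toElementary_injective p he)).trans
    (LinearEquiv.ofEq _ _ (range_toElementary p hg hrel he))).symm

end Modules

end Iwasawa

open Iwasawa in
theorem propositionA2p12 (p : ℕ) [Fact p.Prime] (hp : p ≠ 2)
    (X : Type*) [AddCommGroup X] [Module (Iwasawa.Lam p) X] [Module.Finite (Iwasawa.Lam p) X] :
    (∀ (r d f t : ℕ) (g : Fin d → Iwasawa.Lam p) (l : Fin d → ℕ)
        (a e : Fin f → ℕ) (b : Fin t → ℕ),
      (∀ i, Prime (g i)) → (∀ i n, IsRelPrime (g i) (Iwasawa.omega p n)) →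
      (∀ i, 1 ≤ l i) → (∀ m, 2 ≤ e m) →
      ∀ φ : X →ₗ[Iwasawa.Lam p] Iwasawa.Elementary p r g l a e b, Iwasawa.IsPseudoIso φ →
        ∃ Θ : Iwasawa.frakG p (Iwasawa.Elementary p r g l a e b) ≃ₗ[Iwasawa.Lam p]
            Iwasawa.CyclicSum (fun i => g i ^ l i) ×
              Iwasawa.CyclicSum (fun m => Iwasawa.omegaStep p (a m) ^ (e m - 1)),
          Iwasawa.IsPseudoIso (Θ.toLinearMap ∘ₗ Iwasawa.frakGMap p φ)) ∧
    Module.Finite (Iwasawa.Lam p) (Iwasawa.frakG p X) ∧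
    Module.IsTorsion (Iwasawa.Lam p) (Iwasawa.frakG p X) := by
  refine ⟨fun r d f t g l a e b hg hrel _ he φ hφ => ?_, ?_, ?_⟩
  · have he' : ∀ m, 1 ≤ e m := fun m => (Nat.le_succ 1).trans (he m)
    exact ⟨_, isPseudoIso_comp_frakGMap p hφ (frakGSubElementaryEquiv p hg hrel he')⟩
  · exact Module.Finite.equiv (frakGSubEquiv p X)
  · exact isTorsion_frakG p
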